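/- Consider a two-hop layered network over $\mathbb{F}_2$ with two sources, two relays and two destinations. For $m\in\{1,2\}$ the $m$-th hop at time $t$ is $\mathbf{y}_m[t]=\mathbf{H}_m[t]\mathbf{x}_m[t]$, where $\mathbf{H}_m[t]\in\mathbb{F}_2^{2\times 2}$ has $(j,i)$-th entry $h_{j,i,m}[t]$, the channel from transmitter $i$ to receiver $j$; all these entries are independent over $i,j,m,t$ and $\Pr(h_{j,i,m}[t]=1)=p_{j,i,m}\in[0,1]$. Source $k$ has a uniformly distributed message of $\lfloor nR_k\rfloor$ bits, independent of the other message and of the channels, for destination $k$ ($k=1,2$). In a code of length $n$, the transmit symbol of source $k$ at time $t$ is a function of its message and of $\mathbf{H}_1[1],\dots,\mathbf{H}_1[t]$; the transmit symbol of relay $k$ at time $t$ is a function of its received symbols at times $1,\dots,t-1$ and of $\mathbf{H}_1[s],\mathbf{H}_2[s]$, $s\le t$; destination $k$ decodes from its $n$ received symbols and $\mathbf{H}_1[s],\mathbf{H}_2[s]$, $s\le n$. A pair $(R_1,R_2)$ with $R_1,R_2\ge 0$ is achievable if there is a sequence of such codes whose error probability at each destination tends to $0$ as $n\to\infty$; the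 sum capacity $C_{\mathrm{sum}}$ is the supremum of $R_1+R_2$ over achievable pairs. The cut-set bound is the maximum of $R_1+R_2$ over all $R_1,R_2\ge0$ such that, for every set $\Omega$ of nodes with complement $\Omega^c$, the sum of the $R_k$ over those $k$ whose source lies in $\Omega$ and whose destination lies in $\Omega^c$ is at most $\mathbb{E}(\operatorname{rank}(\mathbf{H}_{\Omega,\Omega^c}))$, where $\mathbf{H}_{\Omega,\Omega^c}$ is the channel matrix from the nodes in $\Omega$ to the nodes in $\Omega^c$. Then in each of the following cases the sum capacity equals the cut-set bound, and it is given as follows. - Symmetric channel: if $p_{1,1,1}=p_{2,2,1}=p_{1,1,2}=p_{2,2,2}$ and $p_{2,1,1}=p_{1,2,1}=p_{2,1,2}=p_{1,2,2}$, then $C_{\mathrm{sum}}=\min\{\mathbb{E}(\operatorname{rank}(\mathbf{H}_1)),\mathbb{E}(\operatorname{rank}(\mathbf{H}_2))\}$. - $Z$ channel: if $p_{2,1,1}=p_{2,1,2}=0$, $p_{1,1,1}=p_{2,2,2}$, $p_{2,2,1}=p_{1,1,2}$ and $p_{1,2,1}=p_{1,2,2}$, then $C_{\mathrm{sum}}=2\min\{p_{1,1,1},p_{2,2,1}\}$.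 - $\Pi$ channel: if $p_{1,1,1}=p_{2,2,2}=0$, $p_{2,1,1}=p_{1,2,2}$, $p_{1,2,1}=p_{2,1,2}$ and $p_{2,2,1}=p_{1,1,2}$, then $C_{\mathrm{sum}}=p_{2,1,1}+p_{1,2,1}$. -/

import Mathlib

open Filter Topology

noncomputable section

/-- A binary channel matrix of one hop: the `(j, i)` entry is the channel from the `i`-th
transmitter to the `j`-th receiver. Indices are `0, 1` instead of `1, 2`. -/
abbrev ChannelMatrix : Type := Matrix (Fin 2) (Fin 2) (ZMod 2)

/-- The link probabilities of a `2`-`2`-`2` network: `p j i m` is the probability that the channel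
from the `i`-th transmitter to the `j`-th receiver of the `m`-th hop equals `1`. -/
abbrev LinkProb : Type := Fin 2 → Fin 2 → Fin 2 → ℝ

/-- Probability that the channel matrix of hop `m` at a given time equals `H`
(independent Bernoulli entries). -/
def matrixProb (p : LinkProb) (m : Fin 2) (H : ChannelMatrix) : ℝ :=
  ∏ j, ∏ i, if H j i = 1 then p j i m else 1 - p j i m

/-- Probability of a whole channel realization `H m t` over two hops and `n` times
(independent over hops and times). -/
def channelProb (p : LinkProb) {n : ℕ} (H : Fin 2 → Fin n → ChannelMatrix) : ℝ :=
  ∏ m, ∏ t, matrixProb p m (H m t)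

/-- A block code of length `n` in which source `k` sends `b k` bits. Channel knowledge is causal:
at time `t` the sources know the first-hop matrices up to time `t`, the relays know the matrices of
both hops up to time `t`, and the destinations decode at the end, knowing both hops.
The relays have received the first-hop outputs strictly before time `t`. -/
structure BlockCode (n : ℕ) (b : Fin 2 → ℕ) where
  /-- encoding function of source `k` at time `t` -/
  enc (k : Fin 2) (t : Fin n) : Fin (2 ^ b k) → (Set.Iic t → ChannelMatrix) → ZMod 2
  /-- relaying function of relay `k` at time `t` -/
  relay (k : Fin 2) (t : Fin n) : (Set.Iio t → ZMod 2) →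
    (Set.Iic t → ChannelMatrix) → (Set.Iic t → ChannelMatrix) → ZMod 2
  /-- decoding function of destination `k` -/
  dec (k : Fin 2) : (Fin n → ZMod 2) →
    (Fin n → ChannelMatrix) → (Fin n → ChannelMatrix) → Fin (2 ^ b k)

namespace BlockCode

variable {n : ℕ} {b : Fin 2 → ℕ}

/-- Transmit vector of the sources at time `t`. -/
def x₁ (c : BlockCode n b) (w : ∀ k, Fin (2 ^ b k)) (H : Fin 2 → Fin n → ChannelMatrix)
    (t : Fin n) : Fin 2 → ZMod 2 :=
  fun k => c.enc k t (w k) (fun s => H 0 s)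

/-- Received vector of the relays at time `t`. -/
def y₁ (c : BlockCode n b) (w : ∀ k, Fin (2 ^ b k)) (H : Fin 2 → Fin n → ChannelMatrix)
    (t : Fin n) : Fin 2 → ZMod 2 :=
  (H 0 t).mulVec (c.x₁ w H t)

/-- Transmit vector of the relays at time `t`. -/
def x₂ (c : BlockCode n b) (w : ∀ k, Fin (2 ^ b k)) (H : Fin 2 → Fin n → ChannelMatrix)
    (t : Fin n) : Fin 2 → ZMod 2 :=
  fun k => c.relay k t (fun s => c.y₁ w H s k) (fun s => H 0 s) (fun s => H 1 s)

/-- Received vector of the destinations at time `t`. -/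
def y₂ (c : BlockCode n b) (w : ∀ k, Fin (2 ^ b k)) (H : Fin 2 → Fin n → ChannelMatrix)
    (t : Fin n) : Fin 2 → ZMod 2 :=
  (H 1 t).mulVec (c.x₂ w H t)

/-- The message decoded by destination `k`. -/
def decoded (c : BlockCode n b) (w : ∀ k, Fin (2 ^ b k)) (H : Fin 2 → Fin n → ChannelMatrix)
    (k : Fin 2) : Fin (2 ^ b k) :=
  c.dec k (fun t => c.y₂ w H t k) (H 0) (H 1)

/-- Probability of error at destination `k`: messages are independent and uniform, and independent
of the channels. -/
def errorProb (p : LinkProb) (c : BlockCode n b) (k : Fin 2) : ℝ :=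
  ∑ w : (∀ l, Fin (2 ^ b l)), ∑ H : Fin 2 → Fin n → ChannelMatrix,
    (∏ l, ((2 : ℝ) ^ b l)⁻¹) * channelProb p H * (if c.decoded w H k ≠ w k then 1 else 0)

end BlockCode

/-- Number of bits that source `k` sends in `n` channel uses at rates `R`. -/
def bits (R : Fin 2 → ℝ) (n : ℕ) : Fin 2 → ℕ := fun k => ⌊(n : ℝ) * R k⌋₊

/-- The rate pair `R` is achievable. -/
def Achievable (p : LinkProb) (R : Fin 2 → ℝ) : Prop :=
  (∀ k, 0 ≤ R k) ∧ ∃ c : ∀ n : ℕ, BlockCode n (bits R n),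
    ∀ k, Tendsto (fun n => (c n).errorProb p k) atTop (𝓝 0)

/-- `C` is the sum capacity: the supremum of the achievable sum-rates. -/
def IsSumCapacity (p : LinkProb) (C : ℝ) : Prop :=
  IsLUB {S : ℝ | ∃ R : Fin 2 → ℝ, Achievable p R ∧ S = ∑ k, R k} C

/-- Average rank of the part of the channel matrix of hop `m` from the transmitters in `T` to the
receivers in `U`. -/
def avgRank (p : LinkProb) (m : Fin 2) (T U : Finset (Fin 2)) : ℝ :=
  ∑ H : ChannelMatrix, matrixProb p m H *
    ((H.submatrix (Subtype.val : U → Fin 2) (Subtype.val : T → Fin 2)).rank : ℝ)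

/-- Average rank of the whole channel matrix of hop `m`. -/
def expRank (p : LinkProb) (m : Fin 2) : ℝ :=
  ∑ H : ChannelMatrix, matrixProb p m H * (H.rank : ℝ)

/-- Value of the cut whose source side consists of the sources in `A`, the relays in `B` and the
destinations in `D`: the average rank of the channel matrix across the cut, which is block diagonal
with one block for each hop. -/
def cutValue (p : LinkProb) (A B D : Finset (Fin 2)) : ℝ :=
  avgRank p 0 A Bᶜ + avgRank p 1 B Dᶜ

/-- `R` satisfies all cut-set inequalities: the sum of the rates of the pairs separated by a cut is
at most the value of the cut. -/
def InCutSetRegion (p : LinkProb) (R : Fin 2 → ℝ) : Prop :=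
  (∀ k, 0 ≤ R k) ∧ ∀ A B D : Finset (Fin 2), ∑ k ∈ A \ D, R k ≤ cutValue p A B D

/-- `C` is the cut-set upper bound on the sum-rate: the largest sum-rate that the cut-set
inequalities allow. -/
def IsCutSetBound (p : LinkProb) (C : ℝ) : Prop :=
  IsGreatest {S : ℝ | ∃ R : Fin 2 → ℝ, InCutSetRegion p R ∧ S = ∑ k, R k} C

/-- Symmetric channel. -/
def IsSymmetricChannel (p : LinkProb) : Prop :=
  (p 0 0 0 = p 1 1 0 ∧ p 1 1 0 = p 0 0 1 ∧ p 0 0 1 = p 1 1 1) ∧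
  (p 1 0 0 = p 0 1 0 ∧ p 0 1 0 = p 1 0 1 ∧ p 1 0 1 = p 0 1 1)

/-- `Z` channel. -/
def IsZChannel (p : LinkProb) : Prop :=
  (p 1 0 0 = 0 ∧ p 1 0 1 = 0) ∧
  p 0 0 0 = p 1 1 1 ∧ p 1 1 0 = p 0 0 1 ∧ p 0 1 0 = p 0 1 1

/-- `Π` channel. -/
def IsPiChannel (p : LinkProb) : Prop :=
  (p 0 0 0 = 0 ∧ p 1 1 1 = 0) ∧
  p 1 0 0 = p 0 1 1 ∧ p 0 1 0 = p 1 0 1 ∧ p 1 1 0 = p 0 0 1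

end

/-! Converse: fix the channels and a cut. The messages decoded correctly across the cut are
determined by the remaining messages and by the signals crossing it, at most `2 ^ rank` per time
(`BlockCode.card_correct_le`). So the fraction of correct messages is at most 2 to the total rank
minus the number of bits. The ranks are independent over time, and Chernoff's bound makes success
exponentially unlikely once the rates exceed the average rank.

Achievability: the time is cut into `N + 1` blocks and the relays forward, without decoding, in one
block what they received in the preceding one. They reorder the symbols so that a first-hop matrix
`H` meets a second-hop matrix `G` for which `G * H`, restricted to the active relays, is the
identity on the active users (`Pairing`): interference cancels over the two hops. A user gets the
sum, over the classes serving it, of a rate not exceeding the class probability in either hop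
(`Pairing.achievable`).

Each channel then needs a pairing that meets some cuts. Inversion over `ZMod 2` preserves the shape
of the matrices (symmetric and `Z`) or turns that of one hop into that of the other (`Π`), so
invertible matrices meet their inverses and serve both users; singular ones serve at most one user
along a single path. -/

noncomputable section

/-! ### Expectations over independent channels, and Chernoff's bound -/

/-- Joint probability of the channel matrices of both hops at a given time. -/
def slotProb (p : LinkProb) (g : Fin 2 → ChannelMatrix) : ℝ := ∏ m, matrixProb p m (g m)

theorem sum_matrix_prod {M : Type*} [CommSemiring M] (F : Fin 2 → Fin 2 → ZMod 2 → M) :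
    ∑ H : ChannelMatrix, ∏ j, ∏ i, F j i (H j i) = ∏ j, ∏ i, ∑ x, F j i x := by
  have h : ∀ j, ∏ i, ∑ x, F j i x = ∑ r : Fin 2 → ZMod 2, ∏ i, F j i (r i) := fun j => by
    rw [Finset.prod_univ_sum, Fintype.piFinset_univ]
  simp_rw [h]
  rw [Finset.prod_univ_sum, Fintype.piFinset_univ]
  rfl

theorem sum_bernoulli_mul (a : ℝ) (f : ZMod 2 → ℝ) :
    ∑ x : ZMod 2, (if x = 1 then a else 1 - a) * f x = a * f 1 + (1 - a) * f 0 := by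
  have : (Finset.univ : Finset (ZMod 2)) = {0, 1} := rfl
  rw [this, Finset.sum_pair (by decide)]
  simp [add_comm]

theorem matrixProb_nonneg {p : LinkProb} (hp : ∀ j i m, 0 ≤ p j i m ∧ p j i m ≤ 1) (m : Fin 2)
    (H : ChannelMatrix) : 0 ≤ matrixProb p m H := by
  refine Finset.prod_nonneg fun j _ => Finset.prod_nonneg fun i _ => ?_
  split_ifs
  · exact (hp j i m).1
  · linarith [(hp j i m).2]

theorem sum_matrixProb (p : LinkProb) (m : Fin 2) : ∑ H, matrixProb p m H = 1 := by
  unfold matrixProb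
  rw [sum_matrix_prod (fun j i x => if x = 1 then p j i m else 1 - p j i m)]
  refine Finset.prod_eq_one fun j _ => Finset.prod_eq_one fun i _ => ?_
  simpa using sum_bernoulli_mul (p j i m) 1

theorem sum_matrixProb_entry (p : LinkProb) (m j i : Fin 2) :
    ∑ H : ChannelMatrix, matrixProb p m H * (if H j i = 1 then 1 else 0) = p j i m := by
  have h : ∀ H : ChannelMatrix, matrixProb p m H * (if H j i = 1 then 1 else 0) =
      ∏ j', ∏ i', (if H j' i' = 1 then p j' i' m else 1 - p j' i' m) *
        (if j' = j ∧ i' = i then (if H j' i' = 1 then 1 else 0) else 1) := fun H => by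
    simp only [Finset.prod_mul_distrib]
    unfold matrixProb
    congr 1
    fin_cases j <;> fin_cases i <;> simp [Fin.prod_univ_two]
  simp_rw [h]
  rw [sum_matrix_prod (fun j' i' x => (if x = 1 then p j' i' m else 1 - p j' i' m) *
        (if j' = j ∧ i' = i then (if x = 1 then 1 else 0) else 1))]
  simp_rw [sum_bernoulli_mul]
  fin_cases j <;> fin_cases i <;> simp [Fin.prod_univ_two]

theorem slotProb_nonneg {p : LinkProb} (hp : ∀ j i m, 0 ≤ p j i m ∧ p j i m ≤ 1)
    (g : Fin 2 → ChannelMatrix) : 0 ≤ slotProb p g :=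
  Finset.prod_nonneg fun _ _ => matrixProb_nonneg hp _ _

theorem sum_slotProb (p : LinkProb) : ∑ g, slotProb p g = 1 := by
  unfold slotProb
  rw [← Fintype.piFinset_univ, ← Finset.prod_univ_sum]
  simp [sum_matrixProb]

theorem sum_slotProb_mul (p : LinkProb) (m : Fin 2) (f : ChannelMatrix → ℝ) :
    ∑ g, slotProb p g * f (g m) = ∑ H, matrixProb p m H * f H := by
  have h : ∀ g : Fin 2 → ChannelMatrix, slotProb p g * f (g m) =
      ∏ m', matrixProb p m' (g m') * (if m' = m then f (g m') else 1) := fun g => by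
    rw [Finset.prod_mul_distrib, slotProb]
    simp
  simp_rw [h]
  rw [← Fintype.piFinset_univ, ← Finset.prod_univ_sum
    (f := fun m' H => matrixProb p m' H * (if m' = m then f H else 1))]
  fin_cases m <;> simp [sum_matrixProb]

theorem channelProb_eq (p : LinkProb) {n : ℕ} (H : Fin 2 → Fin n → ChannelMatrix) :
    channelProb p H = ∏ t, slotProb p (fun m => H m t) :=
  Finset.prod_comm

theorem channelProb_nonneg {p : LinkProb} (hp : ∀ j i m, 0 ≤ p j i m ∧ p j i m ≤ 1) {n : ℕ}
    (H : Fin 2 → Fin n → ChannelMatrix) : 0 ≤ channelProb p H :=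
  Finset.prod_nonneg fun _ _ => Finset.prod_nonneg fun _ _ => matrixProb_nonneg hp _ _

/-- Independence over time: the expectation of a product over time of functions of the channels. -/
theorem sum_channelProb_mul_prod (p : LinkProb) {n : ℕ}
    (F : Fin n → (Fin 2 → ChannelMatrix) → ℝ) :
    ∑ H : Fin 2 → Fin n → ChannelMatrix, channelProb p H * ∏ t, F t (fun m => H m t) =
      ∏ t, ∑ g, slotProb p g * F t g := by
  rw [Finset.prod_univ_sum, Fintype.piFinset_univ]
  refine Fintype.sum_equiv (Equiv.piComm fun _ _ => ChannelMatrix) _ _ fun H => ?_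
  rw [channelProb_eq, Finset.prod_mul_distrib]
  rfl

theorem sum_channelProb (p : LinkProb) (n : ℕ) :
    ∑ H : Fin 2 → Fin n → ChannelMatrix, channelProb p H = 1 := by
  simpa [sum_slotProb] using sum_channelProb_mul_prod p (n := n) fun _ _ => 1

/-- Chernoff's exponent: a random variable with negative mean has moment generating function less
than `1` at some point of `(0, 1)`. -/
theorem exists_sum_mul_exp_lt_one {ι : Type*} [Fintype ι] {q f : ι → ℝ} (hq : ∑ i, q i = 1)
    (hf : ∑ i, q i * f i < 0) :
    ∃ l : ℝ, 0 < l ∧ l < 1 ∧ ∑ i, q i * Real.exp (l * f i) < 1 := by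
  -- The moment generating function is 1 at 0, with the mean as derivative there, so it drops below
  -- 1 just to the right of 0.
  have hd : HasDerivAt (fun l : ℝ => ∑ i, q i * Real.exp (l * f i)) (∑ i, q i * f i) 0 := by
    refine HasDerivAt.fun_sum fun i _ => ?_
    simpa using ((hasDerivAt_mul_const (x := (0 : ℝ)) (f i)).exp).const_mul (q i)
  have h := (hasDerivAt_iff_tendsto_slope.1 hd).eventually (gt_mem_nhds hf)
  have h' : ∀ᶠ l in 𝓝[>] (0 : ℝ), slope (fun l : ℝ => ∑ i, q i * Real.exp (l * f i)) 0 l < 0 :=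
    h.filter_mono (nhdsWithin_mono _ fun x hx => ne_of_gt hx)
  obtain ⟨l, hl, hl01⟩ := (h'.and (Ioo_mem_nhdsGT (one_pos (α := ℝ)))).exists
  refine ⟨l, hl01.1, hl01.2, ?_⟩
  rw [slope_def_field, div_neg_iff] at hl
  rcases hl with hl | hl
  · linarith [hl.2, hl01.1]
  · simpa [hq] using hl.1

/-! ### Converse: the cut-set bound -/

/-- Rank of the part of a channel matrix from the transmitters in `T` to the receivers in `U`. -/
def subRank (T U : Finset (Fin 2)) (H : ChannelMatrix) : ℕ :=
  (H.submatrix (Subtype.val : U → Fin 2) (Subtype.val : T → Fin 2)).rank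

theorem card_range_mulVecLin {a b : Type*} [Fintype a] [Fintype b] (M : Matrix a b (ZMod 2)) :
    Nat.card (LinearMap.range M.mulVecLin) = 2 ^ M.rank := by
  rw [Module.natCard_eq_pow_finrank (K := ZMod 2), Nat.card_zmod, Matrix.rank]

/-- Separates what a receiver gets across the cut from what it gets from transmitters on its own
side, which will be known. -/
theorem mulVec_apply_split (H : ChannelMatrix) (x : Fin 2 → ZMod 2) (T U : Finset (Fin 2))
    (j : U) :
    H.mulVec x j = (H.submatrix (Subtype.val : U → Fin 2) (Subtype.val : T → Fin 2)).mulVec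
      (fun i => x i) j + ∑ i ∈ Tᶜ, H j i * x i := by
  rw [Matrix.mulVec, dotProduct, ← Finset.sum_add_sum_compl T]
  congr 1
  exact (Finset.sum_coe_sort T fun i => H j i * x i).symm

namespace BlockCode

variable {n : ℕ} {b : Fin 2 → ℕ}

/-- For fixed channels, the messages that are decoded correctly across a cut are determined by the
other messages and by the contributions of the source side to the signals crossing the cut. -/
theorem card_correct_le (c : BlockCode n b) (H : Fin 2 → Fin n → ChannelMatrix)
    (A B D : Finset (Fin 2)) :
    Nat.card {w : ∀ k, Fin (2 ^ b k) // ∀ k ∈ A \ D, c.decoded w H k = w k} ≤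
      (∏ k ∈ (A \ D)ᶜ, 2 ^ b k) * ∏ t, 2 ^ (subRank A Bᶜ (H 0 t) + subRank B Dᶜ (H 1 t)) := by
  let M₀ : Fin n → Matrix _ _ (ZMod 2) := fun t =>
    (H 0 t).submatrix (Subtype.val : (Bᶜ : Finset (Fin 2)) → Fin 2) (Subtype.val : A → Fin 2)
  let M₁ : Fin n → Matrix _ _ (ZMod 2) := fun t =>
    (H 1 t).submatrix (Subtype.val : (Dᶜ : Finset (Fin 2)) → Fin 2) (Subtype.val : B → Fin 2)
  let Φ : {w : ∀ k, Fin (2 ^ b k) // ∀ k ∈ A \ D, c.decoded w H k = w k} →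
      (∀ k : ((A \ D)ᶜ : Finset (Fin 2)), Fin (2 ^ b k)) ×
      (∀ t, LinearMap.range (M₀ t).mulVecLin × LinearMap.range (M₁ t).mulVecLin) := fun w =>
    (fun k => w.1 k, fun t => (⟨_, fun i => c.x₁ w.1 H t i, rfl⟩,
      ⟨_, fun i => c.x₂ w.1 H t i, rfl⟩))
  have hΦ : Function.Injective Φ := by
    rintro ⟨w, hw⟩ ⟨w', hw'⟩ h
    have hother : ∀ k ∉ A \ D, w k = w' k := fun k hk =>
      congrFun (congrArg Prod.fst h) ⟨k, Finset.mem_compl.2 hk⟩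
    have h₀ : ∀ t, (M₀ t).mulVec (fun i => c.x₁ w H t i) =
        (M₀ t).mulVec (fun i => c.x₁ w' H t i) := fun t =>
      congrArg Subtype.val (congrArg Prod.fst (congrFun (congrArg Prod.snd h) t))
    have h₁ : ∀ t, (M₁ t).mulVec (fun i => c.x₂ w H t i) =
        (M₁ t).mulVec (fun i => c.x₂ w' H t i) := fun t =>
      congrArg Subtype.val (congrArg Prod.snd (congrFun (congrArg Prod.snd h) t))
    -- From here agreement propagates along the layers on the sink side of the cut: sources, relays,
    -- destinations. The network is layered, so no induction on time is needed.
    have hx₁ : ∀ t, ∀ k ∉ A, c.x₁ w H t k = c.x₁ w' H t k := fun t k hk => by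
      simp only [x₁]
      rw [hother k fun hk' => hk (Finset.mem_sdiff.1 hk').1]
    have hy₁ : ∀ t, ∀ j ∉ B, c.y₁ w H t j = c.y₁ w' H t j := fun t j hj => by
      have hs := fun x => mulVec_apply_split (H 0 t) x A Bᶜ ⟨j, Finset.mem_compl.2 hj⟩
      simp only [y₁]
      rw [hs, hs]
      congr 1
      · exact congrFun (h₀ t) _
      · refine Finset.sum_congr rfl fun i hi => ?_
        rw [hx₁ t i (Finset.mem_compl.1 hi)]
    have hx₂ : ∀ t, ∀ j ∉ B, c.x₂ w H t j = c.x₂ w' H t j := fun t j hj => by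
      simp only [x₂, hy₁ _ j hj]
    have hy₂ : ∀ t, ∀ j ∉ D, c.y₂ w H t j = c.y₂ w' H t j := fun t j hj => by
      have hs := fun x => mulVec_apply_split (H 1 t) x B Dᶜ ⟨j, Finset.mem_compl.2 hj⟩
      simp only [y₂]
      rw [hs, hs]
      congr 1
      · exact congrFun (h₁ t) _
      · refine Finset.sum_congr rfl fun i hi => ?_
        rw [hx₂ t i (Finset.mem_compl.1 hi)]
    refine Subtype.ext (funext fun k => ?_)
    show w k = w' k
    by_cases hk : k ∈ A \ D
    · rw [← hw k hk, ← hw' k hk]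
      simp only [decoded, hy₂ _ k (Finset.mem_sdiff.1 hk).2]
    · exact hother k hk
  have hle := Nat.card_le_card_of_injective Φ hΦ
  refine hle.trans_eq ?_
  rw [Nat.card_prod, Nat.card_pi, Nat.card_pi]
  congr 1
  · simp only [Nat.card_fin]
    exact Finset.prod_coe_sort (A \ D)ᶜ fun k => 2 ^ b k
  · refine Finset.prod_congr rfl fun t _ => ?_
    rw [Nat.card_prod, card_range_mulVecLin, card_range_mulVecLin, pow_add]
    rfl

/-- Union bound, pointwise in messages and channels: either all users of `K` are decoded or some
error indicator is 1. What remains is a count of messages for fixed channels. -/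
theorem one_sub_errorProb_le {p : LinkProb} (hp : ∀ j i m, 0 ≤ p j i m ∧ p j i m ≤ 1)
    (c : BlockCode n b) (K : Finset (Fin 2)) :
    1 - ∑ k, c.errorProb p k ≤ ∑ H : Fin 2 → Fin n → ChannelMatrix, channelProb p H *
      ((∏ l, ((2 : ℝ) ^ b l)⁻¹) *
        Nat.card {w : ∀ k, Fin (2 ^ b k) // ∀ k ∈ K, c.decoded w H k = w k}) := by
  have htot : ∑ H : Fin 2 → Fin n → ChannelMatrix, ∑ w : (∀ l, Fin (2 ^ b l)),
      (∏ l, ((2 : ℝ) ^ b l)⁻¹) * channelProb p H = 1 := by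
    have : ∏ l, ((2 : ℝ) ^ b l)⁻¹ = ((∏ l, (2 : ℝ) ^ b l))⁻¹ := by simp
    simp only [Finset.sum_const, Finset.card_univ, Fintype.card_pi, Fintype.card_fin, nsmul_eq_mul]
    simp_rw [← mul_assoc]
    rw [← Finset.mul_sum, sum_channelProb, mul_one, this]
    push_cast
    exact mul_inv_cancel₀ (by positivity)
  have herr : ∑ k, c.errorProb p k = ∑ H : Fin 2 → Fin n → ChannelMatrix,
      ∑ w : (∀ l, Fin (2 ^ b l)), (∏ l, ((2 : ℝ) ^ b l)⁻¹) * channelProb p H *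
        ∑ k, (if c.decoded w H k ≠ w k then 1 else 0) := by
    simp only [errorProb, Finset.mul_sum]
    rw [Finset.sum_comm]
    simp_rw [Finset.sum_comm (s := (Finset.univ : Finset (Fin 2)))]
    rw [Finset.sum_comm]
  rw [herr, sub_le_iff_le_add, ← Finset.sum_add_distrib]
  refine htot.ge.trans ?_
  refine Finset.sum_le_sum fun H _ => ?_
  have hcard : (Nat.card {w : ∀ k, Fin (2 ^ b k) // ∀ k ∈ K, c.decoded w H k = w k} : ℝ) =
      ∑ w : (∀ l, Fin (2 ^ b l)), if (∀ k ∈ K, c.decoded w H k = w k) then 1 else 0 := by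
    rw [Nat.card_eq_fintype_card, Fintype.card_subtype, Finset.sum_boole]
  rw [hcard, ← mul_assoc, mul_comm (channelProb p H), Finset.mul_sum, ← Finset.sum_add_distrib]
  refine Finset.sum_le_sum fun w _ => ?_
  rw [← mul_add]
  refine le_mul_of_one_le_right
    (mul_nonneg (Finset.prod_nonneg fun _ _ => by positivity) (channelProb_nonneg hp H)) ?_
  have hnn : ∀ k, (0 : ℝ) ≤ if c.decoded w H k ≠ w k then 1 else 0 := fun k => by
    split_ifs <;> norm_num
  by_cases h : ∀ k ∈ K, c.decoded w H k = w k
  · rw [if_pos h]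
    exact le_add_of_nonneg_right (Finset.sum_nonneg fun k _ => hnn k)
  · rw [if_neg h, zero_add]
    push Not at h
    obtain ⟨k, -, hk⟩ := h
    exact le_trans (by rw [if_pos hk])
      (Finset.single_le_sum (fun k _ => hnn k) (Finset.mem_univ k))

end BlockCode

/-- Each floor loses at most one bit, and there are at most two users. -/
theorem sum_bits_ge (R : Fin 2 → ℝ) (n : ℕ) (K : Finset (Fin 2)) :
    n * ∑ k ∈ K, R k - 2 ≤ ∑ k ∈ K, (bits R n k : ℝ) := by
  have h : ∑ k ∈ K, (n * R k - 1) ≤ ∑ k ∈ K, (bits R n k : ℝ) :=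
    Finset.sum_le_sum fun k _ => (Nat.sub_one_lt_floor _).le
  rw [Finset.sum_sub_distrib, ← Finset.mul_sum] at h
  have hK : (K.card : ℝ) ≤ 2 := by exact_mod_cast Finset.card_le_univ K
  simp only [Finset.sum_const, nsmul_eq_mul, mul_one] at h
  linarith

/-- Strong form of the cut-set bound: the probability of correct decoding decays exponentially at
rates outside of the cut-set region. -/
theorem BlockCode.one_sub_errorProb_le_pow {p : LinkProb}
    (hp : ∀ j i m, 0 ≤ p j i m ∧ p j i m ≤ 1) {R : Fin 2 → ℝ} {A B D : Finset (Fin 2)}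
    (h : cutValue p A B D < ∑ k ∈ A \ D, R k) :
    ∃ r : ℝ, 0 ≤ r ∧ r < 1 ∧ ∀ (n : ℕ) (c : BlockCode n (bits R n)),
      1 - ∑ k, c.errorProb p k ≤ r ^ n * 4 := by
  set ρ := ∑ k ∈ A \ D, R k with hρ
  let s : (Fin 2 → ChannelMatrix) → ℝ := fun g => subRank A Bᶜ (g 0) + subRank B Dᶜ (g 1)
  have hmean : ∑ g, slotProb p g * (Real.log 2 * (s g - ρ)) < 0 := by
    have : ∑ g, slotProb p g * (Real.log 2 * (s g - ρ)) =
        Real.log 2 * (cutValue p A B D - ρ) := by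
      have e0 := sum_slotProb_mul p 0 fun H => (subRank A Bᶜ H : ℝ)
      have e1 := sum_slotProb_mul p 1 fun H => (subRank B Dᶜ H : ℝ)
      have : cutValue p A B D = ∑ g, slotProb p g * s g := by
        simp only [s, mul_add, Finset.sum_add_distrib, e0, e1]
        rfl
      have hone := sum_slotProb p
      rw [this, mul_sub, Finset.mul_sum]
      simp only [mul_sub, Finset.sum_sub_distrib]
      congr 1
      · exact Finset.sum_congr rfl fun g _ => by ring
      · rw [← Finset.sum_mul, hone, one_mul]
    rw [this]
    exact mul_neg_of_pos_of_neg (Real.log_pos one_lt_two) (by linarith)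
  obtain ⟨l, hl0, hl1, hl⟩ := exists_sum_mul_exp_lt_one (sum_slotProb p) hmean
  refine ⟨_, Finset.sum_nonneg fun g _ => mul_nonneg (slotProb_nonneg hp g) (Real.exp_nonneg _),
    hl, fun n c => (c.one_sub_errorProb_le hp (A \ D)).trans ?_⟩
  have hE := sum_channelProb_mul_prod p (n := n)
    fun _ g => Real.exp (l * (Real.log 2 * (s g - ρ)))
  rw [Finset.prod_const, Finset.card_univ, Fintype.card_fin] at hE
  rw [← hE, Finset.sum_mul]
  refine Finset.sum_le_sum fun H _ => ?_
  rw [mul_assoc]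
  refine mul_le_mul_of_nonneg_left ?_ (channelProb_nonneg hp H)
  set N := Nat.card {w : ∀ k, Fin (2 ^ bits R n k) // ∀ k ∈ A \ D, c.decoded w H k = w k}
  -- Total rank of the cut minus the number of bits that must cross it.
  set x : ℝ := (∑ t, s (fun m => H m t)) - ∑ k ∈ A \ D, (bits R n k : ℝ) with hx
  have hinv : ∏ k, ((2 : ℝ) ^ bits R n k)⁻¹ = ((∏ k, (2 : ℝ) ^ bits R n k))⁻¹ := by simp
  have hone : (∏ k, ((2 : ℝ) ^ bits R n k)⁻¹) * N ≤ 1 := by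
    have hN : N ≤ ∏ k, 2 ^ bits R n k := by
      refine (Nat.card_le_card_of_injective _ Subtype.val_injective).trans_eq ?_
      simp
    rw [hinv, inv_mul_le_one₀ (by positivity)]
    exact_mod_cast hN
  have hxb : (∏ k, ((2 : ℝ) ^ bits R n k)⁻¹) * N ≤ Real.exp (Real.log 2 * x) := by
    have hN : (N : ℝ) ≤ (∏ k ∈ (A \ D)ᶜ, (2 : ℝ) ^ bits R n k) *
        ∏ t, (2 : ℝ) ^ (subRank A Bᶜ (H 0 t) + subRank B Dᶜ (H 1 t)) := by
      exact_mod_cast c.card_correct_le H A B D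
    have hs : ∏ t, (2 : ℝ) ^ (subRank A Bᶜ (H 0 t) + subRank B Dᶜ (H 1 t)) =
        Real.exp (Real.log 2 * ∑ t, s (fun m => H m t)) := by
      rw [Finset.mul_sum, Real.exp_sum]
      refine Finset.prod_congr rfl fun t _ => ?_
      rw [← Real.rpow_def_of_pos two_pos, ← Real.rpow_natCast]
      simp [s]
    have hb : ∏ k ∈ A \ D, (2 : ℝ) ^ bits R n k =
        Real.exp (Real.log 2 * ∑ k ∈ A \ D, (bits R n k : ℝ)) := by
      rw [Finset.mul_sum, Real.exp_sum]
      refine Finset.prod_congr rfl fun t _ => ?_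
      rw [← Real.rpow_def_of_pos two_pos, ← Real.rpow_natCast]
    rw [hinv, inv_mul_le_iff₀ (by positivity), ← Finset.prod_mul_prod_compl (A \ D), hb]
    refine hN.trans_eq ?_
    rw [hs, hx, mul_sub, Real.exp_sub]
    field_simp
  -- The success fraction is at most `min 1 (2 ^ x)`, hence at most `2 ^ (l * x)` because `0 < l <
  -- 1`.
  have hmin : (∏ k, ((2 : ℝ) ^ bits R n k)⁻¹) * N ≤ Real.exp (l * (Real.log 2 * x)) := by
    rcases le_total 0 x with h0 | h0
    · exact hone.trans (Real.one_le_exp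
        (mul_nonneg hl0.le (mul_nonneg (Real.log_nonneg one_le_two) h0)))
    · refine hxb.trans (Real.exp_le_exp.2 ?_)
      have : Real.log 2 * x ≤ 0 := mul_nonpos_of_nonneg_of_nonpos
        (Real.log_nonneg one_le_two) h0
      nlinarith
  refine hmin.trans ?_
  -- The factor `4 = 2 ^ 2` absorbs the two bits lost by rounding.
  have h4 : (4 : ℝ) = Real.exp (Real.log 2 * 2) := by
    rw [← Real.rpow_def_of_pos two_pos]; norm_num
  rw [← Real.exp_sum, h4, ← Real.exp_add, Real.exp_le_exp, ← Finset.mul_sum, ← Finset.mul_sum,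
    Finset.sum_sub_distrib]
  simp only [Finset.sum_const, Finset.card_univ, Fintype.card_fin, nsmul_eq_mul]
  have hb := sum_bits_ge R n (A \ D)
  rw [← hρ] at hb
  have h2 := Real.log_pos one_lt_two
  have hlog : 0 < l * Real.log 2 := mul_pos hl0 h2
  have hx' : x ≤ (∑ t, s (fun m => H m t)) - n * ρ + 2 := by
    rw [hx]; linarith
  have := mul_le_mul_of_nonneg_left hx' hlog.le
  nlinarith

/-- Cut-set bound. -/
theorem Achievable.inCutSetRegion {p : LinkProb} (hp : ∀ j i m, 0 ≤ p j i m ∧ p j i m ≤ 1)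
    {R : Fin 2 → ℝ} (h : Achievable p R) : InCutSetRegion p R := by
  refine ⟨h.1, fun A B D => ?_⟩
  by_contra! hlt
  obtain ⟨c, hc⟩ := h.2
  obtain ⟨r, hr0, hr1, hr⟩ := BlockCode.one_sub_errorProb_le_pow hp hlt
  have h1 : Tendsto (fun n => 1 - ∑ k, (c n).errorProb p k) atTop (𝓝 (1 - ∑ _k : Fin 2, 0)) :=
    tendsto_const_nhds.sub (tendsto_finsetSum _ fun k _ => hc k)
  have h2 : Tendsto (fun n => r ^ n * 4) atTop (𝓝 (0 * 4)) :=
    (tendsto_pow_atTop_nhds_zero_of_lt_one hr0 hr1).mul_const 4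
  have := le_of_tendsto_of_tendsto' h1 h2 fun n => hr n (c n)
  norm_num at this

/-! ### Block Markov amplify-and-forward codes -/

/-- A pairing of the channel matrices of the two hops. The matrices of each hop are divided into
classes; when both hops are in the same class, relaying the received symbols of `relays` connects
the sources in `users` to their destinations without interference. -/
structure Pairing (S : Type*) where
  /-- class of a channel matrix of each hop -/
  cls : Fin 2 → ChannelMatrix → S
  /-- active source-destination pairs -/
  users : S → Finset (Fin 2)
  /-- active relays -/
  relays : S → Finset (Fin 2)
  neutralizes : ∀ H G, cls 0 H = cls 1 G → ∀ i ∈ users (cls 0 H), ∀ k ∈ users (cls 0 H),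
    ∑ j ∈ relays (cls 0 H), G i j * H j k = if i = k then 1 else 0

/-- The number of the block of length `L`, the class, and the number of earlier times in the
block with the same class. -/
def slotLabel {S : Type*} [DecidableEq S] (f : ChannelMatrix → S) (L : ℕ) {n : ℕ}
    (h : Fin n → ChannelMatrix) (t : Fin n) : ℕ × S × ℕ :=
  ((t : ℕ) / L, f (h t),
    (Finset.univ.filter fun s : Fin n =>
      (s : ℕ) / L = t / L ∧ f (h s) = f (h t) ∧ s < t).card)

/-- Causality: a label depends only on the channels up to its time, so sources and relays can
compute it when they transmit. -/
theorem slotLabel_congr {S : Type*} [DecidableEq S] (f : ChannelMatrix → S) (L : ℕ) {n : ℕ}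
    {h h' : Fin n → ChannelMatrix} {t : Fin n} (H : ∀ s ≤ t, h s = h' s) :
    slotLabel f L h t = slotLabel f L h' t := by
  have : ∀ s : Fin n, ((s : ℕ) / L = t / L ∧ f (h s) = f (h t) ∧ s < t) ↔
      ((s : ℕ) / L = t / L ∧ f (h' s) = f (h' t) ∧ s < t) := fun s => by
    constructor
    · rintro ⟨h1, h2, h3⟩
      exact ⟨h1, by rw [← H s h3.le, ← H t le_rfl, h2], h3⟩
    · rintro ⟨h1, h2, h3⟩
      exact ⟨h1, by rw [H s h3.le, H t le_rfl, h2], h3⟩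
  refine Prod.ext rfl (Prod.ext (congrArg f (H t le_rfl)) ?_)
  simp only [slotLabel]
  rw [Finset.filter_congr fun s _ => this s]

/-- Every number smaller than the size of a set is the rank of one of its elements. -/
theorem Finset.exists_card_filter_lt_eq {α : Type*} [LinearOrder α] (T : Finset α) {k : ℕ}
    (hk : k < T.card) : ∃ t ∈ T, (T.filter (· < t)).card = k := by
  induction T using Finset.induction_on_max with
  | empty => simp at hk
  | insert a T ha ih =>
    have hna : a ∉ T := fun h => lt_irrefl _ (ha a h)
    rw [Finset.card_insert_of_notMem hna] at hk
    rcases Nat.lt_succ_iff_lt_or_eq.1 hk with hk | hk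
    · obtain ⟨t, ht, h⟩ := ih hk
      refine ⟨t, Finset.mem_insert_of_mem ht, ?_⟩
      rw [Finset.filter_insert, if_neg (ha t ht).not_gt, h]
    · refine ⟨a, Finset.mem_insert_self _ _, ?_⟩
      rw [Finset.filter_insert, if_neg (lt_irrefl a), Finset.filter_true_of_mem ha, hk]

/-- Number of times in a block with a given class. -/
def classCount {S : Type*} [DecidableEq S] (f : ChannelMatrix → S) (L : ℕ) {n : ℕ}
    (h : Fin n → ChannelMatrix) (β : ℕ) (σ : S) : ℕ :=
  (Finset.univ.filter fun s : Fin n => (s : ℕ) / L = β ∧ f (h s) = σ).card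

/-- Occurrences of a class in a block are numbered consecutively from 0, so every number below the
count is used. -/
theorem exists_slotLabel_eq {S : Type*} [DecidableEq S] (f : ChannelMatrix → S) (L : ℕ) {n : ℕ}
    (h : Fin n → ChannelMatrix) (β : ℕ) (σ : S) {k : ℕ} (hk : k < classCount f L h β σ) :
    ∃ t, slotLabel f L h t = (β, σ, k) := by
  obtain ⟨t, ht, hc⟩ := Finset.exists_card_filter_lt_eq _ hk
  obtain ⟨-, h1, h2⟩ := Finset.mem_filter.1 ht
  refine ⟨t, Prod.ext h1 (Prod.ext h2 ?_)⟩
  simp only [slotLabel]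
  rw [← hc]
  congr 1
  ext s
  simp [h1, h2, and_assoc]

/-- The value of a signal at a time with a given property, or `0` if there is none. -/
def readAt {α : Type*} (P : α → Prop) (y : α → ZMod 2) : ZMod 2 :=
  open Classical in if h : ∃ s, P s then y h.choose else 0

/-- The time depends on `P` alone and not on the signal, so both relays forward symbols received at
the same time. -/
theorem exists_readAt {α : Type*} {P : α → Prop} (h : ∃ s, P s) :
    ∃ s, P s ∧ ∀ y, readAt P y = y s :=
  ⟨h.choose, h.choose_spec, fun _ => dif_pos h⟩

theorem readAt_congr {α : Type*} {P P' : α → Prop} {y y' : α → ZMod 2} (h : ∀ s, P s ↔ P' s)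
    (hy : ∀ s, P s → y s = y' s) : readAt P y = readAt P' y' := by
  obtain rfl : P = P' := funext fun s => propext (h s)
  unfold readAt
  split_ifs with hP
  · exact hy _ hP.choose_spec
  · rfl

/-- Extension by zero of a signal known on a set of times. -/
def extendZero {α M : Type*} [Zero M] {T : Set α} (f : T → M) (s : α) : M :=
  open Classical in if h : s ∈ T then f ⟨s, h⟩ else 0

theorem extendZero_apply {α M : Type*} [Zero M] {T : Set α} (h : α → M) {s : α} (hs : s ∈ T) :
    extendZero (fun x : T => h x) s = h s :=
  dif_pos hs

/-- Messages embed into bit assignments on `T`. The zeros off `T` keep a user silent in slots that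
do not serve it. -/
theorem exists_encoding {α : Type*} (T : Finset α) {b : ℕ} (hb : b ≤ T.card) :
    ∃ (F : Fin (2 ^ b) → α → ZMod 2) (d : (α → ZMod 2) → Fin (2 ^ b)),
      (∀ w, ∀ x ∉ T, F w x = 0) ∧ ∀ w f, (∀ x ∈ T, f x = F w x) → d f = w := by
  classical
  have hc : Fintype.card (Fin (2 ^ b)) ≤ Fintype.card (T → ZMod 2) := by
    rw [Fintype.card_fun, ZMod.card, Fintype.card_coe, Fintype.card_fin]
    exact Nat.pow_le_pow_right two_pos hb
  obtain ⟨e⟩ := Function.Embedding.nonempty_of_card_le hc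
  refine ⟨fun w x => if h : x ∈ T then e w ⟨x, h⟩ else 0,
    fun f => Function.invFun e fun x => f x, fun w x hx => dif_neg hx, fun w f hf => ?_⟩
  have : (fun x : T => f x) = e w := funext fun x => by
    rw [hf x x.2]
    exact dif_pos x.2
  show Function.invFun e (fun x : T => f x) = w
  rw [this]
  exact Function.leftInverse_invFun e.injective w

/-- The slot in the next block. -/
def nextSlot {S : Type*} (l : ℕ × S × ℕ) : ℕ × S × ℕ := (l.1 + 1, l.2)

theorem nextSlot_injective {S : Type*} : Function.Injective (nextSlot (S := S)) := by
  rintro ⟨a, x⟩ ⟨b, y⟩ h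
  simpa [nextSlot] using h

namespace Pairing

variable {S : Type*} [DecidableEq S]

/-- Block Markov amplify-and-forward code: the symbol received in a slot is forwarded in the slot
with the same class and number in the next block. -/
def code (P : Pairing S) (L : ℕ) {n : ℕ} {b : Fin 2 → ℕ}
    (F : ∀ k, Fin (2 ^ b k) → ℕ × S × ℕ → ZMod 2)
    (d : ∀ k, (ℕ × S × ℕ → ZMod 2) → Fin (2 ^ b k)) : BlockCode n b where
  enc k t w h := F k w (slotLabel (P.cls 0) L (extendZero h) t)
  relay j t y h₀ h₁ :=
    if j ∈ P.relays (slotLabel (P.cls 1) L (extendZero h₁) t).2.1 then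
      -- The condition `s < t` keeps the relay causal; at other times the extended signal is merely
      -- the default 0.
      readAt (fun s => s < t ∧ nextSlot (slotLabel (P.cls 0) L (extendZero h₀) s) =
        slotLabel (P.cls 1) L (extendZero h₁) t) (extendZero y)
    else 0
  dec i y _ h₁ := d i fun l => readAt (fun t => slotLabel (P.cls 1) L h₁ t = nextSlot l) y

variable (P : Pairing S) (L : ℕ) {n : ℕ} {b : Fin 2 → ℕ}
  {F : ∀ k, Fin (2 ^ b k) → ℕ × S × ℕ → ZMod 2}
  {d : ∀ k, (ℕ × S × ℕ → ZMod 2) → Fin (2 ^ b k)}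

theorem code_x₁ (w : ∀ k, Fin (2 ^ b k)) (H : Fin 2 → Fin n → ChannelMatrix) (t : Fin n)
    (k : Fin 2) :
    (P.code L F d).x₁ w H t k = F k (w k) (slotLabel (P.cls 0) L (H 0) t) := by
  show F k (w k) (slotLabel (P.cls 0) L (extendZero _) t) = _
  rw [slotLabel_congr (P.cls 0) L (h' := H 0) fun s hs =>
    extendZero_apply (T := Set.Iic t) (H 0) hs]

theorem code_x₂ (w : ∀ k, Fin (2 ^ b k)) (H : Fin 2 → Fin n → ChannelMatrix) (t : Fin n)
    (j : Fin 2) :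
    (P.code L F d).x₂ w H t j = if j ∈ P.relays (P.cls 1 (H 1 t)) then
      readAt (fun s => s < t ∧ nextSlot (slotLabel (P.cls 0) L (H 0) s) =
        slotLabel (P.cls 1) L (H 1) t) fun s => (P.code L F d).y₁ w H s j else 0 := by
  show (if j ∈ P.relays (slotLabel (P.cls 1) L (extendZero _) t).2.1 then
      readAt (fun s => s < t ∧ nextSlot (slotLabel (P.cls 0) L (extendZero _) s) =
        slotLabel (P.cls 1) L (extendZero _) t) (extendZero _)
    else 0) = _
  rw [slotLabel_congr (P.cls 1) L (h' := H 1) fun s hs =>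
    extendZero_apply (T := Set.Iic t) (H 1) hs]
  congr 1
  refine readAt_congr (fun s => and_congr_right fun hs => ?_) fun s hs =>
    extendZero_apply (T := Set.Iio t) (fun s => (P.code L F d).y₁ w H s j) hs.1
  rw [slotLabel_congr (P.cls 0) L (h' := H 0) fun s' hs' =>
    extendZero_apply (T := Set.Iic t) (H 0) (hs'.trans hs.le)]

/-- The code decodes correctly when all slots that carry data occur in both hops. -/
theorem code_decoded {T : Fin 2 → Finset (ℕ × S × ℕ)} (hT : ∀ k, ∀ l ∈ T k, k ∈ P.users l.2.1)
    (hF : ∀ k w, ∀ l ∉ T k, F k w l = 0)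
    (hd : ∀ k w f, (∀ l ∈ T k, f l = F k w l) → d k f = w)
    (w : ∀ k, Fin (2 ^ b k)) (H : Fin 2 → Fin n → ChannelMatrix) (i : Fin 2)
    (hH : ∀ l ∈ T i, (∃ s, slotLabel (P.cls 0) L (H 0) s = l) ∧
      ∃ t, slotLabel (P.cls 1) L (H 1) t = nextSlot l) :
    (P.code L F d).decoded w H i = w i := by
  refine hd i _ _ fun l hl => ?_
  obtain ⟨⟨s₁, hs₁⟩, ht₁⟩ := hH l hl
  obtain ⟨t, ht, hread⟩ := exists_readAt ht₁
  rw [hread]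
  -- The two times lie in consecutive blocks, so the relay already holds the symbol.
  have hlt : s₁ < t := by
    have h1 : (s₁ : ℕ) / L = l.1 := congrArg Prod.fst hs₁
    have h2 : (t : ℕ) / L = l.1 + 1 := congrArg Prod.fst ht
    by_contra hge
    have := Nat.div_le_div_right (c := L) (Fin.le_def.1 (not_lt.1 hge))
    omega
  -- The time read need not be `s₁` a priori, but it carries the same label, and the transmitted
  -- symbols depend only on the label.
  obtain ⟨s, ⟨-, hs⟩, hread'⟩ := exists_readAt (P := fun s => s < t ∧
    nextSlot (slotLabel (P.cls 0) L (H 0) s) = slotLabel (P.cls 1) L (H 1) t)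
    ⟨s₁, hlt, by rw [hs₁, ht]⟩
  rw [ht] at hs
  replace hs := nextSlot_injective hs
  have hσ₀ : P.cls 0 (H 0 s) = l.2.1 := congrArg (fun l => l.2.1) hs
  have hσ₁ : P.cls 1 (H 1 t) = l.2.1 := congrArg (fun l => l.2.1) ht
  have hx₂ : ∀ j, (P.code L F d).x₂ w H t j =
      if j ∈ P.relays l.2.1 then ∑ k, H 0 s j k * F k (w k) l else 0 := fun j => by
    rw [code_x₂, hread', hσ₁]
    simp only [BlockCode.y₁, Matrix.mulVec, dotProduct, code_x₁, hs]
  have hN := P.neutralizes (H 0 s) (H 1 t) (hσ₀.trans hσ₁.symm)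
  rw [hσ₀] at hN
  have hi := hT i l hl
  calc (P.code L F d).y₂ w H t i
      = ∑ j, H 1 t i j * if j ∈ P.relays l.2.1 then ∑ k, H 0 s j k * F k (w k) l else 0 := by
        simp only [BlockCode.y₂, Matrix.mulVec, dotProduct, hx₂]
    _ = ∑ k, (∑ j ∈ P.relays l.2.1, H 1 t i j * H 0 s j k) * F k (w k) l := by
        simp only [mul_ite, mul_zero, Finset.sum_ite_mem, Finset.univ_inter, Finset.mul_sum,
          Finset.sum_mul, mul_assoc]
        exact Finset.sum_comm
    _ = ∑ k, if i = k then F k (w k) l else 0 := by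
        refine Finset.sum_congr rfl fun k _ => ?_
        -- Active users are separated by `neutralizes`; inactive ones send 0 in this slot.
        by_cases hk : k ∈ P.users l.2.1
        · rw [hN i hi k hk, ite_mul, one_mul, zero_mul]
        · rw [hF k (w k) l fun h => hk (hT k l h), mul_zero, ite_self]
    _ = F i (w i) l := by simp

end Pairing

/-- The dominating function `e` ignores the messages, so the average over them disappears. -/
theorem BlockCode.errorProb_le {p : LinkProb} (hp : ∀ j i m, 0 ≤ p j i m ∧ p j i m ≤ 1)
    {n : ℕ} {b : Fin 2 → ℕ} (c : BlockCode n b) (k : Fin 2)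
    {e : (Fin 2 → Fin n → ChannelMatrix) → ℝ} (he0 : ∀ H, 0 ≤ e H)
    (he : ∀ w H, c.decoded w H k ≠ w k → 1 ≤ e H) :
    c.errorProb p k ≤ ∑ H, channelProb p H * e H := by
  have hinv : ∏ l, ((2 : ℝ) ^ b l)⁻¹ = ((∏ l, (2 : ℝ) ^ b l))⁻¹ := by simp
  have hsum : ∑ _w : (∀ l, Fin (2 ^ b l)), ∏ l, ((2 : ℝ) ^ b l)⁻¹ = 1 := by
    simp only [Finset.sum_const, Finset.card_univ, Fintype.card_pi, Fintype.card_fin, nsmul_eq_mul]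
    rw [hinv]
    push_cast
    exact mul_inv_cancel₀ (by positivity)
  calc c.errorProb p k ≤ ∑ w : (∀ l, Fin (2 ^ b l)), ∑ H : Fin 2 → Fin n → ChannelMatrix,
        (∏ l, ((2 : ℝ) ^ b l)⁻¹) * (channelProb p H * e H) := by
        refine Finset.sum_le_sum fun w _ => Finset.sum_le_sum fun H _ => ?_
        rw [mul_assoc]
        refine mul_le_mul_of_nonneg_left (mul_le_mul_of_nonneg_left ?_ (channelProb_nonneg hp H))
          (Finset.prod_nonneg fun _ _ => by positivity)
        split_ifs with h
        · exact he w H h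
        · exact he0 H
    _ = ∑ H, channelProb p H * e H := by
        rw [← one_mul (∑ H, channelProb p H * e H), ← hsum, Finset.sum_mul]
        simp_rw [Finset.mul_sum]

/-! ### Class counts in a block and achievable rates -/

theorem card_filter_div_eq {n L β : ℕ} (hL : 0 < L) (hn : (β + 1) * L ≤ n) :
    (Finset.univ.filter fun t : Fin n => (t : ℕ) / L = β).card = L := by
  have : (Finset.univ.filter fun t : Fin n => (t : ℕ) / L = β).map Fin.valEmbedding =
      Finset.Ico (β * L) ((β + 1) * L) := by
    ext t
    simp only [Finset.mem_map, Finset.mem_filter, Finset.mem_univ, true_and, Fin.valEmbedding_apply,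
      Finset.mem_Ico]
    constructor
    · rintro ⟨s, rfl, rfl⟩
      exact ⟨Nat.div_mul_le_self _ _, by rw [add_mul, one_mul]; exact Nat.lt_div_mul_add hL⟩
    · intro h
      exact ⟨⟨t, h.2.trans_le hn⟩, Nat.div_eq_of_lt_le h.1 h.2, rfl⟩
  rw [← Finset.card_map Fin.valEmbedding, this, Nat.card_Ico, add_mul, one_mul,
    Nat.add_sub_cancel_left]

/-- Probability that the class of the channel matrix of hop `m` is `σ`. -/
def classProb (p : LinkProb) (m : Fin 2) {S : Type*} [DecidableEq S] (f : ChannelMatrix → S)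
    (σ : S) : ℝ :=
  ∑ H, matrixProb p m H * if f H = σ then 1 else 0

/-- Lower large deviations of the number of occurrences of a class in a block. -/
theorem exists_prob_classCount_lt_le {p : LinkProb} (hp : ∀ j i m, 0 ≤ p j i m ∧ p j i m ≤ 1)
    {S : Type*} [DecidableEq S] (f : ChannelMatrix → S) (m : Fin 2) (σ : S) {x : ℝ}
    (hx : x ≤ 0 ∨ x < classProb p m f σ) :
    ∃ r : ℝ, 0 ≤ r ∧ r < 1 ∧ ∀ n L β : ℕ, 0 < L → (β + 1) * L ≤ n →
      ∑ H : Fin 2 → Fin n → ChannelMatrix, channelProb p H *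
        (if (classCount f L (H m) β σ : ℝ) < L * x then 1 else 0) ≤ r ^ L := by
  rcases hx with hx | hx
  -- Needed for classes of probability zero: a count is never below a nonpositive threshold.
  · refine ⟨0, le_rfl, one_pos, fun n L β hL _ => ?_⟩
    rw [zero_pow hL.ne']
    refine (Finset.sum_eq_zero fun H _ => ?_).le
    rw [if_neg, mul_zero]
    exact not_lt.2 ((mul_nonpos_of_nonneg_of_nonpos (Nat.cast_nonneg L) hx).trans
      (Nat.cast_nonneg _))
  let v : (Fin 2 → ChannelMatrix) → ℝ := fun g => if f (g m) = σ then 1 else 0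
  have hmean : ∑ g, slotProb p g * (x - v g) < 0 := by
    simp only [mul_sub, Finset.sum_sub_distrib]
    rw [← Finset.sum_mul, sum_slotProb, sum_slotProb_mul p m fun H => if f H = σ then (1 : ℝ) else 0]
    rw [one_mul]
    exact sub_neg.2 hx
  obtain ⟨l, hl0, -, hl⟩ := exists_sum_mul_exp_lt_one (sum_slotProb p) hmean
  refine ⟨_, Finset.sum_nonneg fun g _ => mul_nonneg (slotProb_nonneg hp g) (Real.exp_nonneg _),
    hl, fun n L β hL hn => ?_⟩
  -- The exponent is 0 outside block `β`, so exactly `L` factors differ from 1.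
  have hE := sum_channelProb_mul_prod p (n := n)
    fun t g => Real.exp (if (t : ℕ) / L = β then l * (x - v g) else 0)
  have hprod : ∏ t : Fin n, ∑ g, slotProb p g *
      Real.exp (if (t : ℕ) / L = β then l * (x - v g) else 0) =
      (∑ g, slotProb p g * Real.exp (l * (x - v g))) ^ L := by
    have : ∀ t : Fin n, ∑ g, slotProb p g *
        Real.exp (if (t : ℕ) / L = β then l * (x - v g) else 0) =
        if (t : ℕ) / L = β then ∑ g, slotProb p g * Real.exp (l * (x - v g)) else 1 := fun t => by
      split_ifs <;> simp [sum_slotProb]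
    simp_rw [this]
    rw [Finset.prod_ite, Finset.prod_const, Finset.prod_const_one, mul_one,
      card_filter_div_eq hL hn]
  rw [← hprod, ← hE]
  refine Finset.sum_le_sum fun H _ => mul_le_mul_of_nonneg_left ?_ (channelProb_nonneg hp H)
  rw [← Real.exp_sum]
  split_ifs with h
  · rw [Real.one_le_exp_iff, ← Finset.sum_filter, ← Finset.mul_sum, Finset.sum_sub_distrib,
      Finset.sum_const, card_filter_div_eq hL hn, nsmul_eq_mul]
    have : (∑ t ∈ Finset.univ.filter (fun t : Fin n => (t : ℕ) / L = β), v fun m => H m t) =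
        (classCount f L (H m) β σ : ℝ) := by
      simp only [v]
      rw [Finset.sum_boole, Finset.filter_filter, classCount]
    rw [this]
    exact mul_nonneg hl0.le (sub_nonneg.2 h.le)
  · exact Real.exp_nonneg _

namespace Pairing

variable {S : Type*} [DecidableEq S] [Fintype S] (P : Pairing S)

/-- Slots carrying data of user `k`: `N` blocks with `K σ` slots for each class `σ`. -/
def dataSlots (N : ℕ) (K : S → ℕ) (k : Fin 2) : Finset (ℕ × S × ℕ) :=
  (Finset.univ.filter fun σ => k ∈ P.users σ).biUnion fun σ =>
    Finset.range N ×ˢ {σ} ×ˢ Finset.range (K σ)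

theorem mem_dataSlots {N : ℕ} {K : S → ℕ} {k : Fin 2} {l : ℕ × S × ℕ} :
    l ∈ P.dataSlots N K k ↔ k ∈ P.users l.2.1 ∧ l.1 < N ∧ l.2.2 < K l.2.1 := by
  obtain ⟨β, σ, a⟩ := l
  simp only [dataSlots, Finset.mem_biUnion, Finset.mem_filter, Finset.mem_univ, true_and,
    Finset.mem_product, Finset.mem_range, Finset.mem_singleton]
  constructor
  · rintro ⟨σ', h1, h2, rfl, h3⟩
    exact ⟨h1, h2, h3⟩
  · rintro ⟨h1, h2, h3⟩
    exact ⟨σ, h1, h2, rfl, h3⟩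

theorem card_dataSlots (N : ℕ) (K : S → ℕ) (k : Fin 2) :
    (P.dataSlots N K k).card = N * ∑ σ with k ∈ P.users σ, K σ := by
  rw [dataSlots, Finset.card_biUnion, Finset.mul_sum]
  · simp [Finset.card_product]
  · intro σ _ σ' _ h
    refine Finset.disjoint_left.2 ?_
    rintro ⟨β, τ, a⟩ h1 h2
    simp only [Finset.mem_product, Finset.mem_singleton] at h1 h2
    exact h (h1.2.1.symm.trans h2.2.1)

/-- A block Markov code whose error probability is bounded by the probability that some class
occurs too rarely in some block. -/
theorem exists_code {p : LinkProb} (hp : ∀ j i m, 0 ≤ p j i m ∧ p j i m ≤ 1) {n L N : ℕ}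
    (x : S → ℝ) {b : Fin 2 → ℕ}
    (hb : ∀ k, (b k : ℝ) ≤ N * ∑ σ with k ∈ P.users σ, L * x σ) :
    ∃ c : BlockCode n b, ∀ k, c.errorProb p k ≤ ∑ m, ∑ β ∈ Finset.range (N + 1), ∑ σ,
      ∑ H : Fin 2 → Fin n → ChannelMatrix, channelProb p H *
        (if (classCount (P.cls m) L (H m) β σ : ℝ) < L * x σ then 1 else 0) := by
  let K : S → ℕ := fun σ => ⌈L * x σ⌉₊
  have hbT : ∀ k, b k ≤ (P.dataSlots N K k).card := fun k => by
    rw [card_dataSlots, ← Nat.cast_le (α := ℝ)]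
    refine (hb k).trans ?_
    push_cast
    exact mul_le_mul_of_nonneg_left (Finset.sum_le_sum fun σ _ => Nat.le_ceil _)
      (Nat.cast_nonneg _)
  choose F d hF hd using fun k => exists_encoding (P.dataSlots N K k) (hbT k)
  refine ⟨P.code L F d, fun k => ?_⟩
  let e : (Fin 2 → Fin n → ChannelMatrix) → Fin 2 → ℕ → S → ℝ := fun H m β σ =>
    if (classCount (P.cls m) L (H m) β σ : ℝ) < L * x σ then 1 else 0
  have he : ∀ H m β σ, 0 ≤ e H m β σ := fun H m β σ => by
    simp only [e]
    split_ifs <;> norm_num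
  have hsum : ∑ m, ∑ β ∈ Finset.range (N + 1), ∑ σ, ∑ H : Fin 2 → Fin n → ChannelMatrix,
      channelProb p H * e H m β σ = ∑ H : Fin 2 → Fin n → ChannelMatrix, channelProb p H *
        ∑ m, ∑ β ∈ Finset.range (N + 1), ∑ σ, e H m β σ := by
    simp only [Finset.mul_sum]
    symm
    rw [Finset.sum_comm]
    refine Finset.sum_congr rfl fun m _ => ?_
    rw [Finset.sum_comm]
    refine Finset.sum_congr rfl fun β _ => ?_
    rw [Finset.sum_comm]
  rw [show (∑ m, ∑ β ∈ Finset.range (N + 1), ∑ σ, ∑ H : Fin 2 → Fin n → ChannelMatrix,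
      channelProb p H * (if (classCount (P.cls m) L (H m) β σ : ℝ) < L * x σ then 1 else 0)) = _
      from hsum]
  refine BlockCode.errorProb_le hp _ k (fun H => Finset.sum_nonneg fun m _ =>
    Finset.sum_nonneg fun β _ => Finset.sum_nonneg fun σ _ => he H m β σ) fun w H hw => ?_
  by_contra! hlt
  refine hw (P.code_decoded L (T := P.dataSlots N K) (fun k l hl => (P.mem_dataSlots.1 hl).1)
    hF hd w H k fun l hl => ?_)
  have hcount : ∀ m, ∀ β ∈ Finset.range (N + 1), ∀ σ,
      K σ ≤ classCount (P.cls m) L (H m) β σ := fun m β hβ σ => by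
    by_contra! h
    have h1 : e H m β σ = 1 := if_pos (Nat.lt_ceil.1 h)
    have h2 := Finset.single_le_sum (fun σ _ => he H m β σ) (Finset.mem_univ σ)
    have h3 := Finset.single_le_sum (f := fun β => ∑ σ, e H m β σ)
      (fun β _ => Finset.sum_nonneg fun σ _ => he H m β σ) hβ
    have h4 := Finset.single_le_sum (fun m _ => Finset.sum_nonneg fun β _ =>
      Finset.sum_nonneg fun σ _ => he H m β σ) (s := Finset.univ)
      (f := fun m => ∑ β ∈ Finset.range (N + 1), ∑ σ, e H m β σ) (Finset.mem_univ m)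
    linarith
  obtain ⟨β, σ, a⟩ := l
  obtain ⟨-, hβ, ha⟩ := P.mem_dataSlots.1 hl
  simp only at hβ ha
  -- Data of block `β < N` use the first hop in block `β` and the second in block `β + 1 ≤ N`; hence
  -- `N + 1` blocks.
  exact ⟨exists_slotLabel_eq _ L _ β σ (ha.trans_le (hcount 0 β (by simp; omega) σ)),
    exists_slotLabel_eq _ L _ (β + 1) σ (ha.trans_le (hcount 1 (β + 1) (by simpa using hβ) σ))⟩

/-- The rates served by a pairing are achievable up to an arbitrarily small fraction. -/
theorem achievable {p : LinkProb} (hp : ∀ j i m, 0 ≤ p j i m ∧ p j i m ≤ 1) {κ : S → ℝ}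
    (hκ₀ : ∀ σ, 0 ≤ κ σ) (hκ : ∀ m σ, κ σ ≤ classProb p m (P.cls m) σ) {ε : ℝ} (hε₀ : 0 < ε)
    (hε₁ : ε < 1) :
    Achievable p fun k => (1 - ε) * ∑ σ with k ∈ P.users σ, κ σ := by
  set R : Fin 2 → ℝ := fun k => (1 - ε) * ∑ σ with k ∈ P.users σ, κ σ
  have hsum0 : ∀ k, 0 ≤ ∑ σ with k ∈ P.users σ, κ σ := fun k =>
    Finset.sum_nonneg fun σ _ => hκ₀ σ
  refine ⟨fun k => mul_nonneg (by linarith) (hsum0 k), ?_⟩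
  -- The idle block of each hop costs a fraction `1 / (N + 1)`, below `ε / 4`.
  obtain ⟨N, hN⟩ := exists_nat_gt (4 / ε)
  have hN0 : (0 : ℝ) < N := (by positivity : 0 < 4 / ε).trans hN
  have hNε : 4 < N * ε := (div_lt_iff₀ hε₀).1 hN
  -- Half of the slack `ε` puts the thresholds strictly below the positive class probabilities; the
  -- rest pays for the idle block and for rounding the block length.
  let x : S → ℝ := fun σ => (1 - ε / 2) * κ σ
  have hx : ∀ m σ, x σ ≤ 0 ∨ x σ < classProb p m (P.cls m) σ := fun m σ => by
    rcases (hκ₀ σ).eq_or_lt with h | h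
    · left
      simp [x, ← h]
    · right
      refine lt_of_lt_of_le ?_ (hκ m σ)
      simp only [x]
      nlinarith
  choose r hr0 hr1 hr using fun m σ => exists_prob_classCount_lt_le hp (P.cls m) m σ (hx m σ)
  have hlen : ∀ᶠ n : ℕ in atTop, (1 - ε) * n ≤ N * ((n / (N + 1) : ℕ) * (1 - ε / 2)) := by
    filter_upwards [eventually_ge_atTop ⌈4 * (N + 1) / ε⌉₊] with n hn
    have hn' : 4 * (N + 1) / ε ≤ n := Nat.ceil_le.1 hn
    rw [div_le_iff₀ hε₀] at hn'
    have hq : (n : ℝ) < (N + 1) * ((n / (N + 1) : ℕ) + 1) := by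
      exact_mod_cast Nat.lt_mul_div_succ n (Nat.succ_pos N)
    generalize ((n / (N + 1) : ℕ) : ℝ) = q at hq
    have hn0 : (0 : ℝ) ≤ n := Nat.cast_nonneg n
    have hN1 : (0 : ℝ) < N + 1 := by linarith
    refine le_of_mul_le_mul_left ?_ hN1
    have ha : 0 ≤ N * (1 - ε / 2) * ((N + 1) * (q + 1) - n) :=
      mul_nonneg (mul_nonneg hN0.le (by linarith)) (by linarith)
    have hb : 0 ≤ n * (N * ε - 4) := mul_nonneg hn0 (by linarith)
    have hc : 0 ≤ N * (n * ε - 4 * (N + 1)) := mul_nonneg hN0.le (by linarith)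
    have hd : 0 ≤ N * (N + 1) * ε := by positivity
    have he : 0 ≤ n * ε := by positivity
    linarith
  have hcode : ∀ n, ∃ c : BlockCode n (bits R n),
      (1 - ε) * n ≤ N * ((n / (N + 1) : ℕ) * (1 - ε / 2)) → ∀ k, c.errorProb p k ≤
        ∑ m, ∑ β ∈ Finset.range (N + 1), ∑ σ, ∑ H : Fin 2 → Fin n → ChannelMatrix,
          channelProb p H * (if (classCount (P.cls m) (n / (N + 1)) (H m) β σ : ℝ) <
            (n / (N + 1) : ℕ) * x σ then 1 else 0) := fun n => by
    by_cases h : (1 - ε) * n ≤ N * ((n / (N + 1) : ℕ) * (1 - ε / 2))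
    · obtain ⟨c, hc⟩ := P.exists_code hp (n := n) (L := n / (N + 1)) (N := N) x (b := bits R n)
        fun k => by
          refine (Nat.floor_le (mul_nonneg (Nat.cast_nonneg n)
            (mul_nonneg (by linarith) (hsum0 k)))).trans ?_
          have := mul_le_mul_of_nonneg_right h (hsum0 k)
          simp only [x, ← Finset.mul_sum]
          linarith
      exact ⟨c, fun _ => hc⟩
    -- Short lengths, where the data may not fit, get an arbitrary code; they do not affect the
    -- limit.
    · exact ⟨⟨fun _ _ _ _ => 0, fun _ _ _ _ _ => 0, fun _ _ _ _ => 0⟩, fun h' => absurd h' h⟩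
  choose c hc using hcode
  refine ⟨c, fun k => ?_⟩
  have hlim : Tendsto (fun n : ℕ => ∑ m, ∑ _β ∈ Finset.range (N + 1), ∑ σ,
      r m σ ^ (n / (N + 1))) atTop
      (𝓝 (∑ _m : Fin 2, ∑ _β ∈ Finset.range (N + 1), ∑ _σ : S, (0 : ℝ))) :=
    tendsto_finsetSum _ fun m _ => tendsto_finsetSum _ fun β _ => tendsto_finsetSum _ fun σ _ =>
      (tendsto_pow_atTop_nhds_zero_of_lt_one (hr0 m σ) (hr1 m σ)).comp
        (Nat.tendsto_div_const_atTop (Nat.succ_ne_zero N))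
  simp only [Finset.sum_const_zero] at hlim
  refine squeeze_zero' (Eventually.of_forall fun n => ?_) ?_ hlim
  · refine Finset.sum_nonneg fun w _ => Finset.sum_nonneg fun H _ => mul_nonneg (mul_nonneg
      (Finset.prod_nonneg fun _ _ => by positivity) (channelProb_nonneg hp H)) ?_
    split_ifs <;> norm_num
  · filter_upwards [hlen, eventually_ge_atTop (N + 1)] with n hn hnN
    refine (hc n hn k).trans (Finset.sum_le_sum fun m _ => Finset.sum_le_sum fun β hβ =>
      Finset.sum_le_sum fun σ _ => hr m σ n _ β (Nat.div_pos hnN (Nat.succ_pos N)) ?_)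
    exact (Nat.mul_le_mul_right _ (Finset.mem_range.1 hβ)).trans (Nat.mul_div_le n (N + 1))

end Pairing

/-! ### Matching the two bounds; evaluation of ranks -/

theorem le_of_forall_one_sub_mul_le {a c : ℝ} (h : ∀ ε : ℝ, 0 < ε → ε < 1 → (1 - ε) * a ≤ c) :
    a ≤ c := by
  have ht : Tendsto (fun ε : ℝ => (1 - ε) * a) (𝓝[>] 0) (𝓝 ((1 - 0) * a)) :=
    ((continuous_const.sub continuous_id).mul continuous_const).continuousWithinAt
  rw [sub_zero, one_mul] at ht
  refine le_of_tendsto ht ?_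
  filter_upwards [Ioo_mem_nhdsGT (one_pos (α := ℝ))] with ε hε using h ε hε.1 hε.2

/-- No cut inequality has to be checked for `R`: the converse gives them for `(1 - ε) * R`, and `ε`
tends to 0. It thus suffices to bound the sum-rate by a few cuts and to exhibit rates attaining that
bound. -/
theorem isSumCapacity_and_isCutSetBound {p : LinkProb}
    (hp : ∀ j i m, 0 ≤ p j i m ∧ p j i m ≤ 1) {C : ℝ}
    (hC : ∀ R, InCutSetRegion p R → R 0 + R 1 ≤ C) {R : Fin 2 → ℝ} (hR : C ≤ R 0 + R 1)
    (h : ∀ ε : ℝ, 0 < ε → ε < 1 → Achievable p fun k => (1 - ε) * R k) :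
    IsSumCapacity p C ∧ IsCutSetBound p C := by
  have hcut : InCutSetRegion p R := by
    refine ⟨fun k => ?_, fun A B D => le_of_forall_one_sub_mul_le fun ε h0 h1 => ?_⟩
    · have := (h (1 / 2) (by norm_num) (by norm_num)).1 k
      linarith
    · have := ((h ε h0 h1).inCutSetRegion hp).2 A B D
      rwa [← Finset.mul_sum] at this
  have hRC : C = R 0 + R 1 := le_antisymm hR (hC R hcut)
  refine ⟨⟨?_, fun M hM => le_of_forall_one_sub_mul_le fun ε h0 h1 => ?_⟩, ⟨R, hcut, ?_⟩, ?_⟩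
  · rintro S ⟨R', hR', rfl⟩
    rw [Fin.sum_univ_two]
    exact hC R' (hR'.inCutSetRegion hp)
  · refine hM ⟨_, h ε h0 h1, ?_⟩
    rw [← Finset.mul_sum, Fin.sum_univ_two, hRC]
  · rw [Fin.sum_univ_two, hRC]
  · rintro S ⟨R', hR', rfl⟩
    rw [Fin.sum_univ_two]
    exact hC R' hR'

/-- The rank is at most the number of nonzero rows, hence at most the number of nonzero entries.
This crude bound is enough for the cuts used in the `Z` and `Π` channels. -/
theorem subRank_le (T U : Finset (Fin 2)) (H : ChannelMatrix) :
    (subRank T U H : ℝ) ≤ ∑ j ∈ U, ∑ i ∈ T, if H j i = 1 then 1 else 0 := by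
  have h : subRank T U H ≤ (Finset.univ.filter fun j : U => ∃ i ∈ T, H j i = 1).card := by
    refine Matrix.rank_le_card_of_support_subset _ _ fun j hj => ?_
    by_contra hne
    simp only [Finset.coe_filter, Finset.mem_univ, true_and, Set.mem_ofPred_eq, not_exists,
      not_and] at hne
    refine hj (funext fun i => ?_)
    have h01 : ∀ x : ZMod 2, x ≠ 1 → x = 0 := by decide
    exact h01 _ (hne i i.2)
  refine (Nat.cast_le.2 h).trans ?_
  rw [← Finset.sum_boole, ← Finset.sum_coe_sort U]
  refine Finset.sum_le_sum fun j _ => ?_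
  have hnn : ∀ i ∈ T, (0 : ℝ) ≤ if H j i = 1 then 1 else 0 := fun i _ => by
    split_ifs <;> norm_num
  split_ifs with hj
  · obtain ⟨i, hi, hji⟩ := hj
    exact le_trans (by rw [if_pos hji]) (Finset.single_le_sum hnn hi)
  · exact Finset.sum_nonneg hnn

theorem avgRank_le {p : LinkProb} (hp : ∀ j i m, 0 ≤ p j i m ∧ p j i m ≤ 1) (m : Fin 2)
    (T U : Finset (Fin 2)) : avgRank p m T U ≤ ∑ j ∈ U, ∑ i ∈ T, p j i m := by
  calc avgRank p m T U ≤ ∑ H : ChannelMatrix, matrixProb p m H *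
        ∑ j ∈ U, ∑ i ∈ T, (if H j i = 1 then 1 else 0) :=
        Finset.sum_le_sum fun H _ =>
          mul_le_mul_of_nonneg_left (subRank_le T U H) (matrixProb_nonneg hp m H)
    _ = ∑ j ∈ U, ∑ i ∈ T, p j i m := by
        simp_rw [← sum_matrixProb_entry p m, Finset.mul_sum]
        rw [Finset.sum_comm]
        exact Finset.sum_congr rfl fun j _ => Finset.sum_comm

theorem avgRank_le_expRank {p : LinkProb} (hp : ∀ j i m, 0 ≤ p j i m ∧ p j i m ≤ 1) (m : Fin 2)
    (T U : Finset (Fin 2)) : avgRank p m T U ≤ expRank p m :=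
  Finset.sum_le_sum fun H _ => mul_le_mul_of_nonneg_left
    (Nat.cast_le.2 (Matrix.rank_submatrix_le H _ _)) (matrixProb_nonneg hp m H)

theorem matrixProb_apply (p : LinkProb) (m : Fin 2) (H : ChannelMatrix) :
    matrixProb p m H = (if H 0 0 = 1 then p 0 0 m else 1 - p 0 0 m) *
      (if H 0 1 = 1 then p 0 1 m else 1 - p 0 1 m) *
      ((if H 1 0 = 1 then p 1 0 m else 1 - p 1 0 m) *
      (if H 1 1 = 1 then p 1 1 m else 1 - p 1 1 m)) := by
  simp [matrixProb, Fin.prod_univ_two]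

theorem sum_channelMatrix (f : ChannelMatrix → ℝ) :
    ∑ H, f H = ∑ a : ZMod 2, ∑ b : ZMod 2, ∑ c : ZMod 2, ∑ d : ZMod 2, f !![a, b; c, d] := by
  simp_rw [← Fintype.sum_prod_type']
  refine (Fintype.sum_equiv
    ⟨fun x : ZMod 2 × ZMod 2 × ZMod 2 × ZMod 2 => !![x.1, x.2.1; x.2.2.1, x.2.2.2],
      fun H => (H 0 0, H 0 1, H 1 0, H 1 1), fun x => rfl, fun H => ?_⟩ _ _ fun x => rfl).symm
  exact (Matrix.eta_fin_two H).symm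

/-! ### Symmetric channel -/

/-- The second-hop matrix paired with a first-hop matrix of a symmetric channel: the inverse of an
invertible matrix, and the transpose of a singular one. -/
def symPartner (H : ChannelMatrix) : ChannelMatrix :=
  if H 0 0 * H 1 1 + H 0 1 * H 1 0 = 1 then !![H 1 1, H 0 1; H 1 0, H 0 0] else H.transpose

/-- Receiver and transmitter of a nonzero link of a matrix. -/
def activeLink (H : ChannelMatrix) : Fin 2 × Fin 2 :=
  if H 0 0 = 1 then (0, 0) else if H 0 1 = 1 then (0, 1) else if H 1 0 = 1 then (1, 0) else (1, 1)

/-- Users served when both hops are in the class of `H`. -/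
def symUsers (H : ChannelMatrix) : Finset (Fin 2) :=
  if H 0 0 * H 1 1 + H 0 1 * H 1 0 = 1 then Finset.univ
  else if H = 0 then ∅ else {(activeLink H).2}

/-- Relays used when both hops are in the class of `H`. -/
def symRelays (H : ChannelMatrix) : Finset (Fin 2) :=
  if H 0 0 * H 1 1 + H 0 1 * H 1 0 = 1 then Finset.univ else {(activeLink H).1}

theorem symPartner_symPartner : ∀ H, symPartner (symPartner H) = H := by decide

/-- Pairing of a symmetric channel. -/
def symPairing : Pairing ChannelMatrix where
  cls := ![id, symPartner]
  users := symUsers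
  relays := symRelays
  neutralizes := by
    -- For a nonzero singular matrix the transpose returns the active link from the relay to the
    -- user it came from, with gain 1.
    have : ∀ G : ChannelMatrix, ∀ i ∈ symUsers (symPartner G), ∀ k ∈ symUsers (symPartner G),
      ∑ j ∈ symRelays (symPartner G), G i j * symPartner G j k = if i = k then 1 else 0 := by
      decide
    rintro H G rfl
    exact this G

/-- A singular matrix over `ZMod 2` is an outer product, so serving one user already matches its
rank. -/
theorem rank_le_card_symUsers (H : ChannelMatrix) : H.rank ≤ (symUsers H).card := by
  unfold symUsers
  split_ifs with h1 h2
  · exact H.rank_le_card_width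
  · simp [h2]
  · have h : ∀ H : ChannelMatrix, H 0 0 * H 1 1 + H 0 1 * H 1 0 ≠ 1 →
        ∃ w v : Fin 2 → ZMod 2, H = Matrix.vecMulVec w v := by decide
    obtain ⟨w, v, rfl⟩ := h H h1
    rw [Finset.card_singleton]
    exact Matrix.rank_vecMulVec_le w v

/-- Inversion swaps the diagonal entries and transposition the off-diagonal ones; in the symmetric
channel the swapped entries have the same law. -/
theorem matrixProb_symPartner {p : LinkProb} (h : IsSymmetricChannel p) (H : ChannelMatrix) :
    matrixProb p 1 (symPartner H) = matrixProb p 0 H := by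
  obtain ⟨⟨h1, h2, h3⟩, h4, h5, h6⟩ := h
  rw [matrixProb_apply, matrixProb_apply, h1, h2, h3, h4, h5, h6]
  have h01 : ∀ x : ZMod 2, x = 0 ∨ x = 1 := by decide
  rcases h01 (H 0 0) with ha | ha <;> rcases h01 (H 0 1) with hb | hb <;>
    rcases h01 (H 1 0) with hc | hc <;> rcases h01 (H 1 1) with hd | hd <;>
    simp [symPartner, ha, hb, hc, hd, CharTwo.add_self_eq_zero] <;> ring

theorem expRank_eq_of_isSymmetricChannel {p : LinkProb} (h : IsSymmetricChannel p) :
    expRank p 1 = expRank p 0 := by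
  obtain ⟨⟨h1, h2, h3⟩, h4, h5, h6⟩ := h
  simp only [expRank, matrixProb_apply, h1, h2, h3, h4, h5, h6]

theorem classProb_symPairing {p : LinkProb} (h : IsSymmetricChannel p) (m : Fin 2)
    (σ : ChannelMatrix) : classProb p m (symPairing.cls m) σ = matrixProb p 0 σ := by
  have h1 : ∀ H, symPartner H = σ ↔ H = symPartner σ := fun H =>
    ⟨fun h => by rw [← h, symPartner_symPartner], fun h => by rw [h, symPartner_symPartner]⟩
  fin_cases m
  · simp [classProb, symPairing]
  · simp [classProb, symPairing, h1, matrixProb_symPartner h]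

/-! ### `Z` and `Π` channels -/

/-- Classes of the `Z` channel: two of invertible matrices, paired with themselves, one for each
direct path, and the unused matrices. -/
def zClass (H : ChannelMatrix) : Fin 5 :=
  if H 1 0 = 1 then 4
  else if H 0 0 = 1 then (if H 1 1 = 1 then (if H 0 1 = 1 then 1 else 0) else 2)
  else if H 1 1 = 1 then 3 else 4

/-- Pairing of the `Z` channel. -/
def zPairing : Pairing (Fin 5) where
  cls _ := zClass
  users := ![Finset.univ, Finset.univ, {0}, {1}, ∅]
  relays := ![Finset.univ, Finset.univ, {0}, {1}, ∅]
  -- Upper unitriangular matrices over `ZMod 2` are their own inverses.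
  neutralizes := by decide

theorem sum_zmod_two (f : ZMod 2 → ℝ) : ∑ x, f x = f 0 + f 1 := Fin.sum_univ_two f

theorem classProb_zPairing {p : LinkProb} (m : Fin 2) (h : p 1 0 m = 0) (σ : Fin 5) :
    classProb p m (zPairing.cls m) σ =
      (![p 0 0 m * p 1 1 m * (1 - p 0 1 m), p 0 0 m * p 1 1 m * p 0 1 m, p 0 0 m * (1 - p 1 1 m),
        p 1 1 m * (1 - p 0 0 m), (1 - p 0 0 m) * (1 - p 1 1 m)] : Fin 5 → ℝ) σ := by
  fin_cases σ <;>
    simp [classProb, zPairing, zClass, sum_channelMatrix, sum_zmod_two, matrixProb_apply, h] <;>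
    ring

/-- Classes of the `Π` channel: two of invertible matrices, paired with their inverses, one for each
crossed path, and the unused matrices. -/
def piClass (m : Fin 2) (H : ChannelMatrix) : Fin 5 :=
  if H m m = 1 then 4
  else if H (1 - m) m = 1 then
    (if H m (1 - m) = 1 then (if H (1 - m) (1 - m) = 1 then 1 else 0) else 2)
  else if H m (1 - m) = 1 then 3 else 4

/-- Pairing of the `Π` channel. -/
def piPairing : Pairing (Fin 5) where
  cls := piClass
  users := ![Finset.univ, Finset.univ, {0}, {1}, ∅]
  relays := ![Finset.univ, Finset.univ, {1}, {0}, ∅]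
  -- The inverse of `!![0, 1; 1, d]` is `!![d, 1; 1, 0]`, which has the zero where the second hop
  -- has it.
  neutralizes := by decide

theorem classProb_piPairing {p : LinkProb} (m : Fin 2) (h : p m m m = 0) (σ : Fin 5) :
    classProb p m (piPairing.cls m) σ =
      (![p (1 - m) m m * p m (1 - m) m * (1 - p (1 - m) (1 - m) m),
        p (1 - m) m m * p m (1 - m) m * p (1 - m) (1 - m) m,
        p (1 - m) m m * (1 - p m (1 - m) m), p m (1 - m) m * (1 - p (1 - m) m m),
        (1 - p (1 - m) m m) * (1 - p m (1 - m) m)] : Fin 5 → ℝ) σ := by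
  fin_cases m <;> fin_cases σ <;> simp at h <;>
    simp [classProb, piPairing, piClass, sum_channelMatrix, sum_zmod_two, matrixProb_apply, h] <;>
    ring

theorem sum_users_fin_five (κ : Fin 5 → ℝ) (k : Fin 2) :
    ∑ σ with k ∈ (![Finset.univ, Finset.univ, {0}, {1}, ∅] : Fin 5 → Finset (Fin 2)) σ, κ σ =
      κ 0 + κ 1 + κ (if k = 0 then 2 else 3) := by
  rw [Finset.sum_filter]
  fin_cases k <;> simp [Fin.sum_univ_five]

/-! ### Sum capacities of the three channels -/

theorem sumCapacity_symmetric {p : LinkProb} (hp : ∀ j i m, 0 ≤ p j i m ∧ p j i m ≤ 1)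
    (h : IsSymmetricChannel p) :
    IsSumCapacity p (min (expRank p 0) (expRank p 1)) ∧
      IsCutSetBound p (min (expRank p 0) (expRank p 1)) := by
  rw [expRank_eq_of_isSymmetricChannel h, min_self]
  refine isSumCapacity_and_isCutSetBound hp (fun R hR => ?_)
    (R := fun k => ∑ σ with k ∈ symPairing.users σ, matrixProb p 0 σ) ?_ fun ε h0 h1 =>
      symPairing.achievable hp (matrixProb_nonneg hp 0)
        (fun m σ => (classProb_symPairing h m σ).ge) h0 h1
  -- This cut separates the sources from everything else.
  · have h1 := hR.2 Finset.univ ∅ ∅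
    have h2 := avgRank_le_expRank hp 0 Finset.univ ∅ᶜ
    have h3 := avgRank_le hp 1 ∅ ∅ᶜ
    simp only [Finset.sdiff_empty, Fin.sum_univ_two, cutValue] at h1
    simp only [Finset.sum_empty, Finset.sum_const_zero] at h3
    linarith
  · have hsum : ∀ σ : ChannelMatrix, ((symUsers σ).card : ℝ) * matrixProb p 0 σ =
        ∑ k, if k ∈ symUsers σ then matrixProb p 0 σ else 0 := fun σ => by
      rw [Finset.sum_ite_mem, Finset.univ_inter, Finset.sum_const, nsmul_eq_mul]
    simp only [Finset.sum_filter]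
    rw [← Finset.sum_add_distrib]
    refine Finset.sum_le_sum fun σ _ => ?_
    have hσ := hsum σ
    rw [Fin.sum_univ_two] at hσ
    refine le_trans ?_ hσ.le
    rw [mul_comm]
    exact mul_le_mul_of_nonneg_right (Nat.cast_le.2 (rank_le_card_symUsers σ))
      (matrixProb_nonneg hp 0 σ)

theorem sumCapacity_z {p : LinkProb} (hp : ∀ j i m, 0 ≤ p j i m ∧ p j i m ≤ 1)
    (h : IsZChannel p) :
    IsSumCapacity p (2 * min (p 0 0 0) (p 1 1 0)) ∧
      IsCutSetBound p (2 * min (p 0 0 0) (p 1 1 0)) := by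
  obtain ⟨⟨h100, h101⟩, hd0, hd1, hc⟩ := h
  set a := p 0 0 0 with ha
  set b := p 1 1 0 with hb
  set q := p 0 1 0 with hq
  have a0 := hp 0 0 0
  have b0 := hp 1 1 0
  have q0 := hp 0 1 0
  rw [← ha] at a0
  rw [← hb] at b0
  rw [← hq] at q0
  -- The two single-path classes have probabilities `a * (1 - b)` and `b * (1 - a)`, exchanged
  -- between the hops; each can be matched only up to the smaller one.
  let κ : Fin 5 → ℝ := ![a * b * (1 - q), a * b * q, min (a * (1 - b)) (b * (1 - a)),
    min (a * (1 - b)) (b * (1 - a)), 0]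
  have hmin : a * b + min (a * (1 - b)) (b * (1 - a)) = min a b := by
    rw [← min_add_add_left]
    congr 1 <;> ring
  refine isSumCapacity_and_isCutSetBound hp (fun R hR => ?_)
    (R := fun k => ∑ σ with k ∈ zPairing.users σ, κ σ) ?_ fun ε h0 h1 =>
      zPairing.achievable hp ?_ ?_ h0 h1
  -- The first two cuts give `R 0 ≤ a` and `R 1 ≤ a`; the third separates relay 0 from relay 1 and
  -- gives `R 0 + R 1 ≤ 2 * b`.
  · have h1 := hR.2 {0} ∅ ∅
    have h2 := avgRank_le hp 0 {0} ∅ᶜ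
    have h3 := avgRank_le hp 1 ∅ ∅ᶜ
    have h4 := hR.2 {1} Finset.univ {0}
    have h5 := avgRank_le hp 0 {1} Finset.univᶜ
    have h6 := avgRank_le hp 1 Finset.univ {0}ᶜ
    have h7 := hR.2 Finset.univ {0} ∅
    have h8 := avgRank_le hp 0 Finset.univ {0}ᶜ
    have h9 := avgRank_le hp 1 {0} ∅ᶜ
    have e1 : ({0}ᶜ : Finset (Fin 2)) = {1} := by decide
    have e2 : ({1} \ {0} : Finset (Fin 2)) = {1} := by decide
    simp only [Finset.sdiff_empty, Finset.sum_singleton, Finset.compl_empty, Fin.sum_univ_two,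
      Finset.sum_empty, cutValue, e1, e2, Finset.compl_univ, h100, h101, add_zero, zero_add]
      at h1 h2 h3 h4 h5 h6 h7 h8 h9
    rcases min_choice a b with h | h <;> rw [h] <;> linarith
  · have := sum_users_fin_five κ
    show _ ≤ ∑ σ with (0 : Fin 2) ∈ (![Finset.univ, Finset.univ, {0}, {1}, ∅] :
      Fin 5 → Finset (Fin 2)) σ, κ σ + ∑ σ with (1 : Fin 2) ∈ (![Finset.univ, Finset.univ, {0},
      {1}, ∅] : Fin 5 → Finset (Fin 2)) σ, κ σ
    rw [this, this, ← hmin]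
    simp [κ]
    linarith
  · have hn : 0 ≤ min (a * (1 - b)) (b * (1 - a)) := le_min
      (mul_nonneg a0.1 (by linarith)) (mul_nonneg b0.1 (by linarith))
    intro σ
    fin_cases σ
    · exact mul_nonneg (mul_nonneg a0.1 b0.1) (by linarith)
    · exact mul_nonneg (mul_nonneg a0.1 b0.1) q0.1
    · exact hn
    · exact hn
    · exact le_rfl
  · have hn : 0 ≤ (1 - a) * (1 - b) := mul_nonneg (by linarith) (by linarith)
    intro m σ
    have hm : p 1 0 m = 0 := by fin_cases m <;> assumption
    rw [classProb_zPairing m hm]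
    fin_cases m <;> fin_cases σ <;> simp [κ, ← ha, ← hb, ← hq, ← hd0, ← hd1, ← hc] <;> linarith

theorem sumCapacity_pi {p : LinkProb} (hp : ∀ j i m, 0 ≤ p j i m ∧ p j i m ≤ 1)
    (h : IsPiChannel p) :
    IsSumCapacity p (p 1 0 0 + p 0 1 0) ∧ IsCutSetBound p (p 1 0 0 + p 0 1 0) := by
  obtain ⟨⟨h000, h111⟩, h1, h2, h3⟩ := h
  -- Unlike in the `Z` channel, every class is equally likely in both hops, so nothing is lost in
  -- the matching.
  have hcls : ∀ m σ, classProb p m (piPairing.cls m) σ =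
      classProb p 0 (piPairing.cls 0) σ := by
    intro m σ
    have hm : p m m m = 0 := by fin_cases m <;> assumption
    rw [classProb_piPairing m hm, classProb_piPairing 0 h000]
    fin_cases m <;> simp [h1, h2, h3]
  refine isSumCapacity_and_isCutSetBound hp (fun R hR => ?_)
    (R := fun k => ∑ σ with k ∈ piPairing.users σ, classProb p 0 (piPairing.cls 0) σ) ?_
      fun ε h0 h1 => piPairing.achievable hp (fun σ => Finset.sum_nonneg fun H _ =>
        mul_nonneg (matrixProb_nonneg hp 0 H) ?_) (fun m σ => (hcls m σ).ge) h0 h1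
  -- Individual bounds suffice: source 0 has one outgoing link and destination 1 one incoming link,
  -- the others having probability 0.
  · have h4 := hR.2 {0} ∅ ∅
    have h5 := avgRank_le hp 0 {0} ∅ᶜ
    have h6 := avgRank_le hp 1 ∅ ∅ᶜ
    have h7 := hR.2 {1} Finset.univ {0}
    have h8 := avgRank_le hp 0 {1} Finset.univᶜ
    have h9 := avgRank_le hp 1 Finset.univ {0}ᶜ
    have e1 : ({0}ᶜ : Finset (Fin 2)) = {1} := by decide
    have e2 : ({1} \ {0} : Finset (Fin 2)) = {1} := by decide
    simp only [Finset.sdiff_empty, Finset.sum_singleton, Finset.compl_empty, Fin.sum_univ_two,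
      Finset.sum_empty, cutValue, e1, e2, Finset.compl_univ, h000, h111, add_zero, zero_add]
      at h4 h5 h6 h7 h8 h9
    linarith
  · have := sum_users_fin_five fun σ => classProb p 0 (piPairing.cls 0) σ
    show _ ≤ ∑ σ with (0 : Fin 2) ∈ (![Finset.univ, Finset.univ, {0}, {1}, ∅] :
      Fin 5 → Finset (Fin 2)) σ, classProb p 0 (piPairing.cls 0) σ +
      ∑ σ with (1 : Fin 2) ∈ (![Finset.univ, Finset.univ, {0}, {1}, ∅] :
      Fin 5 → Finset (Fin 2)) σ, classProb p 0 (piPairing.cls 0) σ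
    rw [this, this]
    simp only [classProb_piPairing 0 h000]
    simp
    linarith
  · split_ifs <;> norm_num

end

theorem theorem2 (p : LinkProb) (hp : ∀ j i m, 0 ≤ p j i m ∧ p j i m ≤ 1) :
    (IsSymmetricChannel p →
      IsSumCapacity p (min (expRank p 0) (expRank p 1)) ∧
      IsCutSetBound p (min (expRank p 0) (expRank p 1))) ∧
    (IsZChannel p →
      IsSumCapacity p (2 * min (p 0 0 0) (p 1 1 0)) ∧
      IsCutSetBound p (2 * min (p 0 0 0) (p 1 1 0))) ∧
    (IsPiChannel p →
      IsSumCapacity p (p 1 0 0 + p 0 1 0) ∧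
      IsCutSetBound p (p 1 0 0 + p 0 1 0)) :=
  ⟨sumCapacity_symmetric hp, sumCapacity_z hp, sumCapacity_pi hp⟩
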